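/- Let $X$ be a real Banach space with topological dual $X^*$, and let $F:X\times X\to\mathbb{R}$ satisfy $F(x,x)=0$ for all $x\in X$. Suppose that $F(x,\cdot)$ is convex and continuous on $X$ for every $x\in X$, and that $F(\cdot,y)$ is concave and continuous on $X$ for every $y\in X$. Define the operators $A^F,\ {}^F\!A: X\rightrightarrows X^*$ by $$A^F(x)=\{x^*\in X^*: F(x,y)-F(x,x)\ge\langle x^*,y-x\rangle\ \ \forall y\in X\},$$ $${}^F\!A(x)=\{x^*\in X^*: F(x,x)-F(y,x)\ge\langle x^*,y-x\rangle\ \ \forall y\in X\}.$$ Then $A^F$ is maximal monotone, and $A^F(x)={}^F\!A(x)$ for every $x\in X$. Here an operator $T:X\rightrightarrows X^*$ is called monotone if $\langle y^*-x^*,y-x\rangle\ge 0$ whenever $x^*\in T(x)$ and $y^*\in T(y)$; a monotone operator is maximal if its graph $\{(x,x^*): x^*\in T(x)\}$ is not properly included in the graph of any other monotone operator $X\rightrightarrows X^*$. -/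

import Mathlib

namespace BifunctionMonotone

variable {X : Type*} [NormedAddCommGroup X] [NormedSpace ℝ X]

/-- The graph of a multifunction from `X` to its topological dual. -/
def graph (T : X → Set (StrongDual ℝ X)) : Set (X × StrongDual ℝ X) :=
  {p | p.2 ∈ T p.1}

/-- Monotone operators: `⟨y* - x*, y - x⟩ ≥ 0` whenever `x* ∈ T x` and `y* ∈ T y`. -/
def IsMonotoneOperator (T : X → Set (StrongDual ℝ X)) : Prop :=
  ∀ x y : X, ∀ xs ∈ T x, ∀ ys ∈ T y, 0 ≤ (ys - xs) (y - x)

/-- A monotone operator is maximal when its graph is not properly included in the graph of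
any other monotone operator. -/
def IsMaximalMonotoneOperator (T : X → Set (StrongDual ℝ X)) : Prop :=
  IsMonotoneOperator T ∧
    ∀ S : X → Set (StrongDual ℝ X), IsMonotoneOperator S → ¬ graph T ⊂ graph S

/-- The operator `A^F` attached to a bifunction `F` defined on the whole space:
`x* ∈ A^F(x)` iff `F(x, y) - F(x, x) ≥ ⟨x*, y - x⟩` for all `y`. -/
def rightOperator (F : X → X → ℝ) (x : X) : Set (StrongDual ℝ X) :=
  {xs | ∀ y : X, xs (y - x) ≤ F x y - F x x}

/-- The operator `^F A` attached to a bifunction `F` defined on the whole space: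
`x* ∈ ^F A(x)` iff `F(x, x) - F(y, x) ≥ ⟨x*, y - x⟩` for all `y`. -/
def leftOperator (F : X → X → ℝ) (x : X) : Set (StrongDual ℝ X) :=
  {xs | ∀ y : X, xs (y - x) ≤ F x x - F y x}

end BifunctionMonotone

/-!
The two operators agree because `F` vanishes on the diagonal. At a point `z` of the segment from `x`
to `y`, concavity of `F (·, z)` gives `0 = F z z ≥ (1 - t) F x z + t F y z`. An element of `A^F x`
bounds `F x z` from below, hence `F y z` from above, and letting `z` tend to `x` bounds `F y x`.
Such limits along segments exist because a finite convex function on a line is continuous.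
Monotonicity is the sum of the inequalities defining the two operators. For maximality, Hahn–Banach
provides a subgradient of `F z` at `z`; comparing it with a pair monotonically related to the graph
and again letting `z` tend to `x` gives the inequality defining `A^F x`.
-/

namespace BifunctionMonotone

open AffineMap Set

section Convex

variable {E : Type*} [AddCommGroup E] [Module ℝ E] {f : E → ℝ}

theorem continuous_comp_lineMap_of_convexOn (hf : ConvexOn ℝ univ f) (x y : E) :
    Continuous fun t : ℝ => f (lineMap x y t) :=
  (hf.comp_affineMap (lineMap x y)).locallyLipschitz.continuous

theorem le_left_of_convexOn_of_comp_lineMap_le (hf : ConvexOn ℝ univ f) {x y : E} {a b : ℝ}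
    (h : ∀ t ∈ Ioo (0 : ℝ) 1, f (lineMap x y t) ≤ lineMap a b t) : f x ≤ a := by
  have hclosed : IsClosed {t : ℝ | f (lineMap x y t) ≤ lineMap a b t} :=
    isClosed_le (continuous_comp_lineMap_of_convexOn hf x y) lineMap_continuous
  have hzero : (0 : ℝ) ∈ closure (Ioo 0 1) := by
    rw [closure_Ioo zero_ne_one]
    exact left_mem_Icc.2 zero_le_one
  have hmem : f (lineMap x y (0 : ℝ)) ≤ lineMap a b (0 : ℝ) := closure_minimal h hclosed hzero
  rwa [lineMap_apply_zero, lineMap_apply_zero] at hmem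

theorem exists_subgradient_of_convexOn [TopologicalSpace E] [IsTopologicalAddGroup E]
    [ContinuousSMul ℝ E] {s : Set E} (hf : ConvexOn ℝ s f) (hs : IsOpen s)
    (hcont : ContinuousOn f s) {x : E} (hx : x ∈ s) :
    ∃ l : StrongDual ℝ E, ∀ y ∈ s, l (y - x) ≤ f y - f x := by
  have hopen : IsOpen {p : E × ℝ | p.1 ∈ s ∧ f p.1 < p.2} := by
    have hsub : ContinuousOn (fun p : E × ℝ => p.2 - f p.1) (s ×ˢ univ) :=
      continuousOn_snd.sub (hcont.comp continuousOn_fst fun _ hp => hp.1)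
    convert hsub.isOpen_inter_preimage (hs.prod isOpen_univ) (isOpen_Ioi (a := (0 : ℝ))) using 1
    ext p
    simp
  obtain ⟨φ, hφ⟩ := geometric_hahn_banach_open_point (x := (x, f x)) hf.convex_strict_epigraph
    hopen fun h => lt_irrefl _ h.2
  have hsplit (v : E) (r : ℝ) : φ (v, r) = φ (v, 0) + r * φ (0, 1) := by
    rw [← smul_eq_mul, ← map_smul, ← map_add]
    simp
  have hsep {y : E} (hy : y ∈ s) {r : ℝ} (hr : f y < r) :
      φ (y - x, 0) + (r - f x) * φ (0, 1) < 0 := by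
    rw [← hsplit, ← Prod.mk_sub_mk, map_sub, sub_neg]
    exact hφ (y, r) ⟨hy, hr⟩
  have hneg : φ (0, 1) < 0 := by
    simpa [Prod.mk_zero_zero] using hsep hx (lt_add_one (f x))
  refine ⟨(-φ (0, 1))⁻¹ • φ.comp (.inl ℝ E ℝ), fun y hy => ?_⟩
  rw [le_sub_iff_add_le]
  refine le_of_forall_gt_imp_ge_of_dense fun r hr => ?_
  rw [← le_sub_iff_add_le]
  change (-φ (0, 1))⁻¹ * φ (y - x, 0) ≤ r - f x
  rw [inv_mul_le_iff₀ (neg_pos.2 hneg)]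
  linarith [hsep hy hr]

end Convex

variable {X : Type*} [NormedAddCommGroup X] [NormedSpace ℝ X] {F : X → X → ℝ}

theorem IsMonotoneOperator.isMaximalMonotoneOperator_of_forall_mem {T : X → Set (StrongDual ℝ X)}
    (hT : IsMonotoneOperator T)
    (hrel : ∀ x xs, (∀ y, ∀ ys ∈ T y, 0 ≤ (ys - xs) (y - x)) → xs ∈ T x) :
    IsMaximalMonotoneOperator T := by
  refine ⟨hT, fun S hS hlt => hlt.not_subset fun p hp => hrel p.1 p.2 fun y ys hys => ?_⟩
  have hyS : (y, ys) ∈ graph S := hlt.subset hys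
  exact hS p.1 y p.2 hp ys hyS

theorem rightOperator_subset_leftOperator (hdiag : ∀ x, F x x = 0)
    (hconvex : ∀ x, ConvexOn ℝ univ (F x)) (hconcave : ∀ y, ConcaveOn ℝ univ fun x => F x y)
    (x : X) : rightOperator F x ⊆ leftOperator F x := by
  intro xs hxs y
  suffices F y x ≤ -xs (y - x) by
    rw [hdiag]
    linarith
  refine le_left_of_convexOn_of_comp_lineMap_le (y := y) (b := 0) (hconvex y)
    fun t ⟨ht₀, ht₁⟩ => ?_
  set z := lineMap x y t with hz
  have hconc : (1 - t) * F x z + t * F y z ≤ 0 := by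
    have h := (hconcave z).2 (mem_univ x) (mem_univ y) (sub_nonneg.2 ht₁.le) ht₀.le (by ring)
    simpa only [← lineMap_apply_module x y t, ← hz, hdiag, smul_eq_mul] using h
  have hsubgrad : t * xs (y - x) ≤ F x z := by
    have h := hxs z
    rwa [hdiag, sub_zero, hz, lineMap_apply_module', add_sub_cancel_right, map_smul,
      smul_eq_mul] at h
  rw [lineMap_apply_module, smul_eq_mul, smul_zero, add_zero]
  refine le_of_mul_le_mul_left ?_ ht₀
  calc t * F y z ≤ -((1 - t) * F x z) := by linarith
    _ ≤ -((1 - t) * (t * xs (y - x))) :=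
      neg_le_neg (mul_le_mul_of_nonneg_left hsubgrad (sub_nonneg.2 ht₁.le))
    _ = t * ((1 - t) * -xs (y - x)) := by ring

theorem rightOperator_neg_swap (F : X → X → ℝ) :
    rightOperator (fun x y => -F y x) = leftOperator F := by
  ext x xs
  simp only [rightOperator, leftOperator, neg_sub_neg]

theorem leftOperator_neg_swap (F : X → X → ℝ) :
    leftOperator (fun x y => -F y x) = rightOperator F := by
  ext x xs
  simp only [rightOperator, leftOperator, neg_sub_neg]

theorem rightOperator_eq_leftOperator (hdiag : ∀ x, F x x = 0)
    (hconvex : ∀ x, ConvexOn ℝ univ (F x)) (hconcave : ∀ y, ConcaveOn ℝ univ fun x => F x y) :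
    rightOperator F = leftOperator F := by
  funext x
  refine (rightOperator_subset_leftOperator hdiag hconvex hconcave x).antisymm ?_
  rw [← rightOperator_neg_swap F, ← leftOperator_neg_swap F]
  exact rightOperator_subset_leftOperator (F := fun x y => -F y x)
    (fun z => neg_eq_zero.2 (hdiag z)) (fun z => (hconcave z).neg) (fun z => (hconvex z).neg) x

theorem isMonotoneOperator_rightOperator (hdiag : ∀ x, F x x = 0)
    (hsubset : ∀ x, rightOperator F x ⊆ leftOperator F x) :
    IsMonotoneOperator (rightOperator F) := by
  intro x y xs hxs ys hys
  have hxs_le : xs (y - x) ≤ F x y := by simpa only [hdiag, sub_zero] using hxs y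
  have hle_ys : F x y ≤ ys (y - x) := by
    have h := hsubset y hys x
    rw [← neg_sub y x, map_neg, hdiag] at h
    linarith
  exact sub_nonneg.2 (hxs_le.trans hle_ys)

theorem mem_rightOperator_of_forall_nonneg (hdiag : ∀ x, F x x = 0)
    (hconvex : ∀ x, ConvexOn ℝ univ (F x)) (hcont : ∀ x, Continuous (F x))
    (hconcave : ∀ y, ConcaveOn ℝ univ fun x => F x y) {x : X} {xs : StrongDual ℝ X}
    (hrel : ∀ y, ∀ ys ∈ rightOperator F y, 0 ≤ (ys - xs) (y - x)) :
    xs ∈ rightOperator F x := by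
  intro y
  suffices -F x y ≤ -xs (y - x) by
    rw [hdiag]
    linarith
  refine le_left_of_convexOn_of_comp_lineMap_le (y := y) (b := 0) (hconcave y).neg
    fun t ⟨ht₀, ht₁⟩ => ?_
  set z := lineMap x y t with hz
  obtain ⟨zs, hzs⟩ := exists_subgradient_of_convexOn (hconvex z) isOpen_univ
    (hcont z).continuousOn (mem_univ z)
  have hle : xs (y - x) ≤ zs (y - x) := by
    have h := hrel z zs fun w => hzs w (mem_univ w)
    rw [hz, lineMap_apply_module', add_sub_cancel_right, map_smul, smul_eq_mul] at h
    exact sub_nonneg.1 (nonneg_of_mul_nonneg_right h ht₀)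
  have hsubgrad : (1 - t) * zs (y - x) ≤ F z y := by
    have h := hzs y (mem_univ y)
    have hyz : y - z = (1 - t) • (y - x) := by
      rw [hz, lineMap_apply_module']
      module
    rwa [hyz, map_smul, smul_eq_mul, hdiag, sub_zero] at h
  rw [lineMap_apply_module, smul_eq_mul, smul_zero, add_zero, mul_neg]
  exact neg_le_neg ((mul_le_mul_of_nonneg_left hle (sub_nonneg.2 ht₁.le)).trans hsubgrad)

end BifunctionMonotone

open BifunctionMonotone in
theorem mainTheorem8_general {X : Type*} [NormedAddCommGroup X] [NormedSpace ℝ X]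
    (F : X → X → ℝ)
    (hdiag : ∀ x : X, F x x = 0)
    (hconvex : ∀ x : X, ConvexOn ℝ Set.univ (fun y : X => F x y))
    (hcont_right : ∀ x : X, Continuous (fun y : X => F x y))
    (hconcave : ∀ y : X, ConcaveOn ℝ Set.univ (fun x : X => F x y)) :
    IsMaximalMonotoneOperator (rightOperator F) ∧ rightOperator F = leftOperator F := by
  have hmono : IsMonotoneOperator (rightOperator F) :=
    isMonotoneOperator_rightOperator hdiag
      (rightOperator_subset_leftOperator hdiag hconvex hconcave)
  have hmax : IsMaximalMonotoneOperator (rightOperator F) :=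
    hmono.isMaximalMonotoneOperator_of_forall_mem fun _ _ hrel =>
      mem_rightOperator_of_forall_nonneg hdiag hconvex hcont_right hconcave hrel
  exact ⟨hmax, rightOperator_eq_leftOperator hdiag hconvex hconcave⟩

theorem mainTheorem8 {X : Type*} [NormedAddCommGroup X] [NormedSpace ℝ X] [CompleteSpace X]
    (F : X → X → ℝ)
    (hdiag : ∀ x : X, F x x = 0)
    (hconvex : ∀ x : X, ConvexOn ℝ Set.univ (fun y : X => F x y))
    (hcont_right : ∀ x : X, Continuous (fun y : X => F x y))
    (hconcave : ∀ y : X, ConcaveOn ℝ Set.univ (fun x : X => F x y))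
    (hcont_left : ∀ y : X, Continuous (fun x : X => F x y)) :
    BifunctionMonotone.IsMaximalMonotoneOperator (BifunctionMonotone.rightOperator F) ∧
      BifunctionMonotone.rightOperator F = BifunctionMonotone.leftOperator F :=
  mainTheorem8_general F hdiag hconvex hcont_right hconcave
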